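/- Let $f:\mathbb R^d\to\mathbb R^d$, let $p\ge 1$ be an integer, and let $\Omega\subset\mathbb R^d$ be a set of initial values (for instance $\Omega=\mathbb R^d$, an open set, or a single point) such that $f$ is of class $C^p$ in a neighbourhood of every point of $\Omega$. Let an $s$-stage Runge--Kutta method with coefficients $A=(a_{ij})\in\mathbb R^{s\times s}$ and $b\in\mathbb R^s$ be given; one step from $y_0$ with step size $h$ is $$Y_i=y_0+h\sum_{j=1}^s a_{ij}f(Y_j)\quad(i=1,\dots,s),\qquad y_1=y_0+h\sum_{i=1}^s b_if(Y_i),$$ where $Y_i=Y_i(h)\to y_0$ as $h\to0$. The method has order $p$ (for this $f$ on $\Omega$) if for every $y_0\in\Omega$ the solution $y$ of $y'=f(y)$, $y(0)=y_0$, and the stages $Y_i(h)$ exist for small $h$, and $y_1(h)-y(h)=O(h^{p+1})$ as $h\to0$. For an unlabelled rooted tree $T=[T_1\cdots T_l]$ with root-subtrees $T_1,\dots,T_l$ ($l=0$ for the one-vertex tree), let $|T|$ be the number of its vertices, $\gamma(T)=|T|\prod_i\gamma(T_i)$, $\sigma(T)=\prod_i\sigma(T_i)\cdot\prod_k m_k!$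 with $m_k$ the multiplicities of the distinct trees among $T_1,\dots,T_l$, and $\alpha(T)=|T|!/(\sigma(T)\gamma(T))$. Let $$T(f)(y)=f^{(l)}(y)\big(T_1(f)(y),\dots,T_l(f)(y)\big).$$ With $\hat A=\begin{bmatrix}A&0\\ b^\top&0\end{bmatrix}\in\mathbb R^{(s+1)\times(s+1)}$ let $\hat\Phi(T)\in\mathbb R^{s+1}$ be given by $\hat\Phi(T)_i=\sum_j\hat A_{ij}\prod_{k=1}^l\hat\Phi(T_k)_j$, and let $\phi(T)$ be the last component of $\hat\Phi(T)$. For each $j$ let $T_1,\dots,T_{N_j}$ be the distinct unlabelled rooted trees with $j$ vertices, let $\mathbb T_j(f)$ be the linear span of the functions $T_1(f),\dots,T_{N_j}(f)$ on $\Omega$, let $\mathcal T_{j,1},\dots,\mathcal T_{j,n_j}$ be any basis of $\mathbb T_j(f)$, and let $\mathcal M_j\in\mathbb R^{n_j\times N_j}$ be the matrix with $$(T_1(f),\dots,T_{N_j}(f))=(\mathcal T_{j,1},\dots,\mathcal T_{j,n_j})\,\mathcal M_j .$$ Put $\alpha_j=(\alpha(T_1),\dots,\alpha(T_{N_j}))$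 and $W_j=\operatorname{diag}\big(\gamma(T_1)\phi(T_1),\dots,\gamma(T_{N_j})\phi(T_{N_j})\big)$. **Theorem.** The Runge--Kutta method has order $p$ for $f$ on $\Omega$ if and only if $$\alpha_j\mathcal M_j^\top=\alpha_jW_j\mathcal M_j^\top\qquad\text{for all } j\le p .$$ Moreover, for each $j$ the condition $\alpha_j\mathcal M_j^\top=\alpha_jW_j\mathcal M_j^\top$ does not depend on the choice of the basis: it holds for one basis of $\mathbb T_j(f)$ if and only if it holds for every other one. -/

import Mathlib

open scoped Matrix Topology

namespace RungeKutta

/-! ### Rooted trees -/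

/-- Rooted trees with ordered children: `node l c` is the tree `[c 0, ..., c (l - 1)]`;
`l = 0` gives the tree with a single vertex. -/
inductive OrderedTree : Type
  | node (l : ℕ) (c : Fin l → OrderedTree) : OrderedTree

namespace OrderedTree

/-- Two ordered rooted trees are isomorphic as rooted trees when, recursively, their children
agree up to a permutation. -/
inductive Iso : OrderedTree → OrderedTree → Prop
  | node {l : ℕ} {c c₂ : Fin l → OrderedTree} (e : Equiv.Perm (Fin l))
      (h : ∀ i, Iso (c i) (c₂ (e i))) : Iso (node l c) (node l c₂)

theorem Iso.refl (t : OrderedTree) : Iso t t := by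
  induction t with
  | node l c ih => exact .node (Equiv.refl _) ih

theorem Iso.symm {t u : OrderedTree} (h : Iso t u) : Iso u t := by
  induction h with
  | @node l c c₂ e _ ih =>
    refine .node e.symm fun i => ?_
    have := ih (e.symm i)
    rwa [Equiv.apply_symm_apply] at this

theorem Iso.trans {t u v : OrderedTree} (h : Iso t u) (h₂ : Iso u v) : Iso t v := by
  induction h generalizing v with
  | @node l c c₂ e _ ih =>
    cases h₂ with
    | @node _ _ c₃ e₂ h₃ => exact .node (e.trans e₂) fun i => ih i (h₃ (e i))

instance setoid : Setoid OrderedTree where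
  r := Iso
  iseqv := ⟨Iso.refl, Iso.symm, Iso.trans⟩

/-- The order `|T|`: the number of vertices. -/
def order : OrderedTree → ℕ
  | node _ c => 1 + ∑ i, (c i).order

/-- The density `γ(T) = T! = |T| ∏ γ(Tᵢ)`. -/
def gamma : OrderedTree → ℕ
  | node l c => (node l c).order * ∏ i, (c i).gamma

open Classical in
/-- The symmetry `σ(T) = ∏ mᵢ! σ(Tᵢ) ^ mᵢ`, where `mᵢ` are the multiplicities of the distinct
(that is, pairwise non-isomorphic) children. -/
noncomputable def sigma : OrderedTree → ℕ
  | node _ c =>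
    (∏ i, (c i).sigma) *
      ∏ C ∈ Finset.univ.image (fun i => (⟦c i⟧ : Quotient setoid)),
        (Finset.univ.filter (fun i => (⟦c i⟧ : Quotient setoid) = C)).card.factorial

/-- For a square matrix `A` over a finite index type, the vector obtained by contracting the
network of shape `T` in which a vertex with `l` children carries `A Iˡ`
(`Iˡ` the diagonal tensor of order `l + 1`). -/
def stageVector {ι : Type} [Fintype ι] (A : Matrix ι ι ℝ) : OrderedTree → ι → ℝ
  | node _ c => fun i => ∑ j, A i j * ∏ k, stageVector A (c k) j

/-- The tree tensor network (elementary differential)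
`T(f)(y) = f⁽ˡ⁾(y) (T₁(f)(y), ..., T_l(f)(y))`. -/
noncomputable def network {E : Type} [NormedAddCommGroup E] [NormedSpace ℝ E] (f : E → E) :
    OrderedTree → E → E
  | node l c => fun y => iteratedFDeriv ℝ l f y (fun i => network f (c i) y)

theorem order_congr {t u : OrderedTree} (h : Iso t u) : t.order = u.order := by
  induction h with
  | @node l c c₂ e _ ih =>
    simp only [order, ih]
    rw [Equiv.sum_comp e (fun i => (c₂ i).order)]

theorem gamma_congr {t u : OrderedTree} (h : Iso t u) : t.gamma = u.gamma := by
  induction h with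
  | @node l c c₂ e h ih =>
    simp only [gamma, ih, order_congr (.node e h)]
    rw [Equiv.prod_comp e (fun i => (c₂ i).gamma)]

theorem sigma_congr {t u : OrderedTree} (h : Iso t u) : t.sigma = u.sigma := by
  classical
  induction h with
  | @node l c c₂ e h ih =>
    have hq : ∀ i, (⟦c i⟧ : Quotient setoid) = ⟦c₂ (e i)⟧ := fun i => Quotient.sound (h i)
    simp only [sigma, ih, hq]
    rw [Equiv.prod_comp e (fun i => (c₂ i).sigma)]
    congr 1
    have himg : Finset.univ.image (fun i => (⟦c₂ (e i)⟧ : Quotient setoid)) =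
        Finset.univ.image (fun i => (⟦c₂ i⟧ : Quotient setoid)) := by
      ext C
      simp only [Finset.mem_image, Finset.mem_univ, true_and]
      exact ⟨fun ⟨i, hi⟩ => ⟨e i, hi⟩, fun ⟨i, hi⟩ => ⟨e.symm i, by simpa using hi⟩⟩
    rw [himg]
    refine Finset.prod_congr rfl fun C _ => ?_
    congr 1
    exact Finset.card_bij (fun i _ => e i) (by simp) (by simp)
      (fun i hi => ⟨e.symm i, by simpa using hi, by simp⟩)

theorem stageVector_congr {ι : Type} [Fintype ι] (A : Matrix ι ι ℝ) {t u : OrderedTree}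
    (h : Iso t u) : t.stageVector A = u.stageVector A := by
  induction h with
  | @node l c c₂ e _ ih =>
    funext i
    simp only [stageVector, ih]
    refine Finset.sum_congr rfl fun j _ => ?_
    rw [Equiv.prod_comp e (fun k => (c₂ k).stageVector A j)]

theorem one_le_order (t : OrderedTree) : 1 ≤ t.order := by
  cases t with
  | node l c => simp [order]

theorem finite_order_le (n : ℕ) : {t : OrderedTree | t.order ≤ n}.Finite := by
  induction n with
  | zero =>
    convert Set.finite_empty
    ext t
    have := one_le_order t
    simp only [Set.mem_empty_iff_false, iff_false]
    change ¬ t.order ≤ 0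
    omega
  | succ n ih =>
    have hfin : (⋃ l ∈ Set.Iic n, (fun c : Fin l → OrderedTree => node l c) ''
        (Set.univ.pi fun _ => {t : OrderedTree | t.order ≤ n})).Finite :=
      (Set.finite_Iic n).biUnion fun l _ => (Set.Finite.pi fun _ => ih).image _
    refine hfin.subset ?_
    rintro ⟨l, c⟩ ht
    have ht₂ : 1 + ∑ i, (c i).order ≤ n + 1 := ht
    have hl : l ≤ ∑ i, (c i).order := by
      simpa using Finset.card_nsmul_le_sum Finset.univ (fun i => (c i).order) 1
        (fun i _ => one_le_order (c i))
    simp only [Set.mem_iUnion]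
    refine ⟨l, by simp only [Set.mem_Iic]; omega, c, fun i _ => ?_, rfl⟩
    have := Finset.single_le_sum (f := fun i => (c i).order) (fun _ _ => Nat.zero_le _)
      (Finset.mem_univ i)
    change (c i).order ≤ n
    change (c i).order ≤ ∑ i, (c i).order at this
    omega

end OrderedTree

/-- Unlabelled rooted trees: isomorphism classes of rooted trees. -/
def RootedTree : Type := Quotient OrderedTree.setoid

namespace RootedTree

/-- The order `|T|` (number of vertices). -/
def order (T : RootedTree) : ℕ :=
  Quotient.lift OrderedTree.order (fun _ _ => OrderedTree.order_congr) T

/-- The density `γ(T)`. -/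
def gamma (T : RootedTree) : ℕ :=
  Quotient.lift OrderedTree.gamma (fun _ _ => OrderedTree.gamma_congr) T

/-- The symmetry `σ(T)`. -/
noncomputable def sigma (T : RootedTree) : ℕ :=
  Quotient.lift OrderedTree.sigma (fun _ _ => OrderedTree.sigma_congr) T

/-- `α(T) = |T|! / (σ(T) γ(T))`. -/
noncomputable def alpha (T : RootedTree) : ℝ :=
  (T.order.factorial : ℝ) / ((T.sigma : ℝ) * (T.gamma : ℝ))

/-- The contraction of the network of shape `T` with components `A Iˡ`. -/
def stageVector {ι : Type} [Fintype ι] (A : Matrix ι ι ℝ) (T : RootedTree) : ι → ℝ :=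
  Quotient.lift (OrderedTree.stageVector A) (fun _ _ => OrderedTree.stageVector_congr A) T

/-- The tree tensor network `T(f)`, read off from any ordering of the children; for `f` of class
`C^(|T| - 1)` near `y` the value at `y` does not depend on the ordering, because the derivatives
of `f` are symmetric. -/
noncomputable def network {E : Type} [NormedAddCommGroup E] [NormedSpace ℝ E] (f : E → E)
    (T : RootedTree) : E → E :=
  OrderedTree.network f (Quotient.out T)

end RootedTree

/-- The distinct unlabelled rooted trees of order `j`. -/
abbrev TreeOfOrder (j : ℕ) : Type := {T : RootedTree // T.order = j}

instance finite_treeOfOrder (j : ℕ) : Finite (TreeOfOrder j) := by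
  refine Set.Finite.subset ((OrderedTree.finite_order_le j).image
    (fun t => (Quotient.mk OrderedTree.setoid t : RootedTree))) ?_
  intro T hT
  obtain ⟨t, rfl⟩ := Quotient.exists_rep T
  exact ⟨t, le_of_eq hT, rfl⟩

noncomputable instance fintype_treeOfOrder (j : ℕ) : Fintype (TreeOfOrder j) :=
  Fintype.ofFinite _

/-! ### Runge-Kutta methods -/

/-- The `(s + 1) × (s + 1)` block matrix with rows `(A, 0)` and `(bᵀ, 0)`. -/
def augmented {s : ℕ} (A : Matrix (Fin s) (Fin s) ℝ) (b : Fin s → ℝ) :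
    Matrix (Fin s ⊕ Unit) (Fin s ⊕ Unit) ℝ :=
  Matrix.fromBlocks A 0 (Matrix.of fun _ j => b j) 0

/-- The elementary weight `φ(T)`: the last component of the contraction of the network of shape
`T` built from the augmented matrix. -/
def phi {s : ℕ} (A : Matrix (Fin s) (Fin s) ℝ) (b : Fin s → ℝ) (T : RootedTree) : ℝ :=
  T.stageVector (augmented A b) (Sum.inr ())

/-- `y` solves `y' = f(y)` near `0` with `y(0) = y₀`. -/
def IsExactSolution {E : Type} [NormedAddCommGroup E] [NormedSpace ℝ E] (f : E → E) (y₀ : E)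
    (y : ℝ → E) : Prop :=
  y 0 = y₀ ∧ ∀ᶠ t in 𝓝 (0 : ℝ), HasDerivAt y (f (y t)) t

/-- One step of the Runge-Kutta method `(A, b)` from `y₀`, as a function of the step size `h`
near `0`: the stages `Y i h` solve the stage equations and tend to `y₀` as `h → 0` (this selects
the right branch when the method is implicit), and `y₁ h` is the new value. -/
structure IsStep {E : Type} [NormedAddCommGroup E] [NormedSpace ℝ E] {s : ℕ}
    (A : Matrix (Fin s) (Fin s) ℝ) (b : Fin s → ℝ) (f : E → E) (y₀ : E)
    (Y : Fin s → ℝ → E) (y₁ : ℝ → E) : Prop where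
  tendsto_stage : ∀ i, Filter.Tendsto (Y i) (𝓝 0) (𝓝 y₀)
  stage : ∀ᶠ h in 𝓝 (0 : ℝ), ∀ i, Y i h = y₀ + h • ∑ j, A i j • f (Y j h)
  update : ∀ᶠ h in 𝓝 (0 : ℝ), y₁ h = y₀ + h • ∑ i, b i • f (Y i h)

/-- The Runge-Kutta method `(A, b)` has order `p` for the system `y' = f(y)` with initial values
in `Ω`: from every `y₀ ∈ Ω` the exact solution and the step of the method exist for small `h`,
and the local error `y₁(h) - y(h)` is `O(h ^ (p + 1))`. -/
def HasOrder {E : Type} [NormedAddCommGroup E] [NormedSpace ℝ E] {s : ℕ}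
    (A : Matrix (Fin s) (Fin s) ℝ) (b : Fin s → ℝ) (f : E → E) (Ω : Set E) (p : ℕ) : Prop :=
  ∀ y₀ ∈ Ω,
    (∃ y, IsExactSolution f y₀ y) ∧
    (∃ Y y₁, IsStep A b f y₀ Y y₁) ∧
    ∀ y Y y₁, IsExactSolution f y₀ y → IsStep A b f y₀ Y y₁ →
      (fun h => y₁ h - y h) =O[𝓝 (0 : ℝ)] (fun h => h ^ (p + 1))

/-! ### The span of the networks of a given order, and the vectors and matrices of the
order conditions -/

/-- `T(f)` as a function on `Ω`. -/
noncomputable def networkOn {E : Type} [NormedAddCommGroup E] [NormedSpace ℝ E] (f : E → E)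
    (Ω : Set E) (T : RootedTree) : Ω → E :=
  fun y => T.network f y

/-- `𝕋_j(f)`: the linear span of the functions `T(f)` on `Ω`, over all trees with `|T| = j`. -/
noncomputable def networkSpan {E : Type} [NormedAddCommGroup E] [NormedSpace ℝ E] (f : E → E)
    (Ω : Set E) (j : ℕ) : Submodule ℝ (Ω → E) :=
  Submodule.span ℝ {g | ∃ T : RootedTree, T.order = j ∧ g = networkOn f Ω T}

/-- `M` expresses the networks of order `j` in the basis `B` of their span:
`(T₁(f), ..., T_N(f)) = (B₁, ..., B_n) M`. -/
def Expresses {E : Type} [NormedAddCommGroup E] [NormedSpace ℝ E] (f : E → E) (Ω : Set E)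
    (j : ℕ) {n : ℕ} (B : Module.Basis (Fin n) ℝ (networkSpan f Ω j))
    (M : Matrix (Fin n) (TreeOfOrder j) ℝ) : Prop :=
  ∀ T : TreeOfOrder j, networkOn f Ω T.1 = ∑ k, M k T • (B k : Ω → E)

/-- The row vector `α_j = (α(T))` over the trees of order `j`. -/
noncomputable def alphaVec (j : ℕ) : TreeOfOrder j → ℝ :=
  fun T => T.1.alpha

open Classical in
/-- The diagonal matrix `W_j = diag(γ(T) φ(T))` over the trees of order `j`. -/
noncomputable def weightMatrix {s : ℕ} (A : Matrix (Fin s) (Fin s) ℝ) (b : Fin s → ℝ) (j : ℕ) :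
    Matrix (TreeOfOrder j) (TreeOfOrder j) ℝ :=
  Matrix.diagonal fun T => (T.1.gamma : ℝ) * phi A b T.1

end RungeKutta

/-!
Both the exact solution `y(h)` and the numerical value `y₁(h)` have an expansion in powers of `h`
whose coefficients are combinations of the elementary differentials `T(f)(y₀)`, with a remainder
`O(h ^ (p + 1))`. The method has order `p` if and only if the two polynomials agree, for all
`y₀ ∈ Ω`.

The expansions are indexed by plane trees (`OrderedTree`), for which no symmetry factors appear.
If `δ = ∑ h ^ |t| x(t) t(f)(y₀)` up to some order, then inserting this sum in the Taylor polynomial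
of `f` and expanding by multilinearity yields one term for each tuple `(t₁, ..., t_l)`, that is, for
each plane tree `[t₁, ..., t_l]`, with coefficient `(1 / l!) ∏ x(tᵢ)` (`comp_bSeries_isBigO`). The
equations `Y - y₀ = h A f(Y)` and `(y - y₀)' = f(y)` gain one power of `h`, so they can be solved
order by order. With `w(t)` the product of `1 / l!` over the vertices of `t`, the coefficients are
`w(t) Φ(t)` for the stages (`stage_sub_bSeries_isBigO`), hence `w(t) φ(t)` for `y₁`, which is the
last stage of the augmented method, and `w(t) / γ(t)` for the exact solution
(`exact_sub_bSeries_isBigO`).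

By the symmetry of the derivatives of `f`, plane trees with the same underlying rooted tree `T` have
the same elementary differential (`network_congr`), and their weights `w` add up to `1 / σ(T)` by
orbit-stabilizer counting (`sum_planeWeight_planeReps`). Thus the coefficient of `h ^ j` in
`y₁(h) - y(h)` is `-(1 / j!) ∑ α(T) (1 - γ(T) φ(T)) T(f)(y₀)`, the sum being over `|T| = j`. The
order conditions say that this function vanishes on `Ω` (`hasOrder_iff_orderDefect`); the coordinates of
the sum in a basis of `𝕋_j(f)` are the entries of `α_j M_jᵀ - α_j W_j M_jᵀ`, and whether they vanish
does not depend on the basis (`vecMul_eq_iff_orderDefect`).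
-/

namespace RungeKutta

open OrderedTree Asymptotics Filter

/-! ### Calculus: symmetry of higher derivatives, remainder estimates, local existence -/

/-- Invariance under an adjacent transposition, by induction on the order of the derivative:
exchanging the first two arguments is the symmetry of the second derivative of `D ^ (n - 1) f`, and
the other transpositions act on the value of `D ^ n f`, which is then differentiated once more. -/
theorem iteratedFDeriv_comp_swap {E F : Type*} [NormedAddCommGroup E] [NormedSpace ℝ E]
    [NormedAddCommGroup F] [NormedSpace ℝ F] {f : E → F} {n : ℕ} (i : Fin n) {x : E}
    (hf : ContDiffAt ℝ (n + 1 : ℕ) f x) (v : Fin (n + 1) → E) :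
    iteratedFDeriv ℝ (n + 1) f x (v ∘ Equiv.swap i.castSucc i.succ) =
      iteratedFDeriv ℝ (n + 1) f x v := by
  induction n generalizing x with
  | zero => exact i.elim0
  | succ n ih =>
    have hd : DifferentiableAt ℝ (iteratedFDeriv ℝ (n + 1) f) x :=
      hf.differentiableAt_iteratedFDeriv (by norm_cast; omega)
    induction i using Fin.cases with
    | zero =>
      have h2 : ContDiffAt ℝ 2 (iteratedFDeriv ℝ n f) x :=
        hf.iteratedFDeriv_right (by norm_cast; omega)
      have hs : IsSymmSndFDerivAt ℝ (iteratedFDeriv ℝ n f) x :=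
        h2.isSymmSndFDerivAt (by simp)
      have hdd : DifferentiableAt ℝ (fderiv ℝ (iteratedFDeriv ℝ n f)) x :=
        (h2.fderiv_right (m := 1) (by norm_num)).differentiableAt (by simp)
      have key : ∀ u : Fin (n + 1 + 1) → E, iteratedFDeriv ℝ (n + 1 + 1) f x u =
          fderiv ℝ (fderiv ℝ (iteratedFDeriv ℝ n f)) x (u 0) (u 1) (Fin.tail (Fin.tail u)) := by
        intro u
        rw [hd.iteratedFDeriv_succ_apply_left']
        have : (fun y => iteratedFDeriv ℝ (n + 1) f y (Fin.tail u)) =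
            fun y => fderiv ℝ (iteratedFDeriv ℝ n f) y (u 1) (Fin.tail (Fin.tail u)) := by
          funext y
          rw [iteratedFDeriv_succ_apply_left]
          rfl
        rw [this]
        have h3 : HasFDerivAt (fun y => fderiv ℝ (iteratedFDeriv ℝ n f) y (u 1))
            ((fderiv ℝ (fderiv ℝ (iteratedFDeriv ℝ n f)) x).flip (u 1)) x := by
          simpa using hdd.hasFDerivAt.clm_apply (hasFDerivAt_const (u 1) x)
        have h4 := ((ContinuousMultilinearMap.apply ℝ (fun _ : Fin n => E) F
          (Fin.tail (Fin.tail u))).hasFDerivAt).comp x h3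
        have h5 := h4.fderiv
        simp only [Function.comp_def, ContinuousMultilinearMap.apply_apply] at h5
        rw [h5]
        simp
      rw [key, key, hs.eq]
      congr 1
    | succ i =>
      rw [hd.iteratedFDeriv_succ_apply_left', hd.iteratedFDeriv_succ_apply_left']
      have h0 : (v ∘ Equiv.swap i.succ.castSucc i.succ.succ) 0 = v 0 := by
        simp only [Function.comp]
        rw [Equiv.swap_apply_of_ne_of_ne] <;> simp [Fin.ext_iff]
      have ht : Fin.tail (v ∘ Equiv.swap i.succ.castSucc i.succ.succ) =
          Fin.tail v ∘ Equiv.swap i.castSucc i.succ := by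
        funext k
        simp only [Fin.tail, Function.comp, ← Fin.succ_castSucc]
        rw [(Fin.succ_injective _).swap_apply]
      rw [h0, ht]
      congr 1
      apply Filter.EventuallyEq.fderiv_eq
      have hf1 : ContDiffAt ℝ (n + 1 : ℕ) f x := hf.of_le (by norm_cast; omega)
      filter_upwards [hf1.eventually (by simp)] with y hy
      exact ih i hy _

/-- The higher derivatives of a `C^n` function are symmetric: adjacent transpositions generate the
symmetric group. -/
theorem iteratedFDeriv_comp_perm {E F : Type*} [NormedAddCommGroup E] [NormedSpace ℝ E]
    [NormedAddCommGroup F] [NormedSpace ℝ F] {f : E → F} {n : ℕ} {x : E}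
    (hf : ContDiffAt ℝ n f x) (e : Equiv.Perm (Fin n)) (v : Fin n → E) :
    iteratedFDeriv ℝ n f x (v ∘ e) = iteratedFDeriv ℝ n f x v := by
  cases n with
  | zero => congr 1; exact Subsingleton.elim _ _
  | succ n =>
    have he : e ∈ Submonoid.closure
        (Set.range fun i : Fin n => Equiv.swap i.castSucc i.succ) := by
      rw [Equiv.Perm.mclosure_swap_castSucc_succ]; trivial
    induction he using Submonoid.closure_induction generalizing v with
    | mem e he => obtain ⟨i, rfl⟩ := he; exact iteratedFDeriv_comp_swap i hf v
    | one => rfl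
    | mul e e₂ _ _ ih ih₂ =>
      rw [Equiv.Perm.coe_mul, ← Function.comp_assoc, ih₂, ih]

/-- Taylor's formula with remainder `O(‖x‖ ^ (n + 1))` for a map that is `C^(n + 1)` at a point. -/
theorem taylor_isBigO {E F : Type*} [NormedAddCommGroup E] [NormedSpace ℝ E]
    [NormedAddCommGroup F] [NormedSpace ℝ F] [CompleteSpace F] {f : E → F} {n : ℕ} {y : E}
    (hf : ContDiffAt ℝ (n + 1 : ℕ) f y) :
    (fun x => f (y + x) - ∑ l ∈ Finset.range (n + 1),
      ((l.factorial : ℝ)⁻¹) • iteratedFDeriv ℝ l f y (fun _ => x)) =O[𝓝 0]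
      fun x => ‖x‖ ^ (n + 1) := by
  have hc : ContinuousAt (iteratedFDeriv ℝ (n + 1) f) y :=
    (hf.iteratedFDeriv_right (i := n + 1) (m := 0) (by simp)).continuousAt
  have hb : ∀ᶠ z in 𝓝 y, ‖iteratedFDeriv ℝ (n + 1) f z‖ < ‖iteratedFDeriv ℝ (n + 1) f y‖ + 1 :=
    hc.norm.eventually (gt_mem_nhds (lt_add_one _))
  obtain ⟨ε, hε, hball⟩ := Metric.eventually_nhds_iff_ball.1 (hb.and (hf.eventually (by simp)))
  set C := ‖iteratedFDeriv ℝ (n + 1) f y‖ + 1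
  refine Asymptotics.IsBigO.of_bound ((n.factorial : ℝ)⁻¹ * C) ?_
  filter_upwards [Metric.ball_mem_nhds (0 : E) hε] with x hx
  have hmem : ∀ t ∈ Set.Icc (0 : ℝ) 1, y + t • x ∈ Metric.ball y ε := by
    intro t ht
    rw [mem_ball_zero_iff] at hx
    rw [mem_ball_iff_norm, add_sub_cancel_left, norm_smul, Real.norm_of_nonneg ht.1]
    exact lt_of_le_of_lt (mul_le_of_le_one_left (norm_nonneg _) ht.2) hx
  rw [map_add_eq_sum_add_integral_iteratedFDeriv (f := f) (x := y) (y := x) (n := n)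
    (fun t ht => by exact_mod_cast (hball _ (hmem t ht)).2), add_sub_cancel_left, norm_smul,
    norm_inv, RCLike.norm_natCast, mul_assoc]
  gcongr
  have := intervalIntegral.norm_integral_le_of_norm_le_const (a := (0 : ℝ)) (b := 1)
    (f := fun t => (1 - t) ^ n • iteratedFDeriv ℝ (n + 1) f (y + t • x) (fun _ => x))
    (C := C * ‖x‖ ^ (n + 1)) ?_
  · simpa using this
  · intro t ht
    rw [Set.uIoc_of_le zero_le_one] at ht
    have ht' : t ∈ Set.Icc (0 : ℝ) 1 := ⟨ht.1.le, ht.2⟩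
    rw [norm_smul, norm_pow, Real.norm_of_nonneg (by linarith [ht.2])]
    refine le_trans (mul_le_of_le_one_left (norm_nonneg _)
      (pow_le_one₀ (by linarith [ht.2]) (by linarith [ht.1]))) ?_
    refine (ContinuousMultilinearMap.le_opNorm _ _).trans ?_
    simp only [Finset.prod_const, Finset.card_univ, Fintype.card_fin]
    gcongr
    exact (hball _ (hmem t ht')).1.le

/-- If `R 0 = 0` and `R' = O(h ^ n)` then `R = O(h ^ (n + 1))`. -/
theorem isBigO_pow_succ_of_hasDerivAt {E : Type*} [NormedAddCommGroup E] [NormedSpace ℝ E]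
    {R R' : ℝ → E} {n : ℕ} (h0 : R 0 = 0) (hR : ∀ᶠ t in 𝓝 (0 : ℝ), HasDerivAt R (R' t) t)
    (hO : R' =O[𝓝 0] fun h : ℝ => h ^ n) : R =O[𝓝 0] fun h : ℝ => h ^ (n + 1) := by
  obtain ⟨C, hC, hO⟩ := hO.exists_pos
  obtain ⟨ε, hε, hball⟩ := Metric.eventually_nhds_iff_ball.1 (hR.and hO.bound)
  refine Asymptotics.IsBigO.of_bound C ?_
  filter_upwards [Metric.ball_mem_nhds (0 : ℝ) hε] with h hh
  rw [mem_ball_zero_iff] at hh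
  have hsub : ∀ t ∈ Metric.closedBall (0 : ℝ) ‖h‖, t ∈ Metric.ball (0 : ℝ) ε := fun t ht => by
    rw [mem_closedBall_zero_iff] at ht
    exact mem_ball_zero_iff.2 (ht.trans_lt hh)
  have := (convex_closedBall (0 : ℝ) ‖h‖).norm_image_sub_le_of_norm_hasDerivWithin_le
    (f := R) (f' := R') (C := C * ‖h‖ ^ n) (x := 0) (y := h)
    (fun t ht => (hball t (hsub t ht)).1.hasDerivWithinAt)
    (fun t ht => by
      refine (hball t (hsub t ht)).2.trans ?_
      rw [norm_pow]
      have : ‖t‖ ≤ ‖h‖ := by simpa using ht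
      gcongr)
    (by simp) (by simp)
  simpa [h0, pow_succ, mul_assoc] using this

/-- Existence of the stages, by the implicit function theorem applied to
`(h, Y) ↦ Y - y₀ - h A f(Y)`, whose derivative in `Y` at `h = 0` is the identity. -/
theorem exists_isStep {E : Type} [NormedAddCommGroup E] [NormedSpace ℝ E] [CompleteSpace E] {s : ℕ}
    (A : Matrix (Fin s) (Fin s) ℝ) (b : Fin s → ℝ) {f : E → E} {y₀ : E}
    (hf : ContDiffAt ℝ 1 f y₀) : ∃ Y y₁, IsStep A b f y₀ Y y₁ := by
  let G : ℝ × (Fin s → E) → (Fin s → E) := fun u i => u.2 i - u.1 • ∑ j, A i j • f (u.2 j)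
  let u₀ : ℝ × (Fin s → E) := (0, fun _ => y₀)
  have hG : ContDiffAt ℝ 1 G u₀ := by
    rw [contDiffAt_pi]
    intro i
    have hj : ∀ j, ContDiffAt ℝ 1 (fun u : ℝ × (Fin s → E) => u.2 j) u₀ := fun j => by fun_prop
    refine (hj i).sub (contDiffAt_fst.smul (ContDiffAt.sum fun j _ => ?_))
    exact contDiffAt_const.smul (ContDiffAt.comp u₀ (g := f) hf (hj j))
  have hinr : fderiv ℝ G u₀ ∘L .inr ℝ ℝ (Fin s → E) = .id ℝ _ := by
    have h1 : HasFDerivAt (fun Y : Fin s → E => G (0, Y))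
        (fderiv ℝ G u₀ ∘L .inr ℝ ℝ (Fin s → E)) (fun _ => y₀) :=
      HasFDerivAt.comp (fun _ => y₀ : Fin s → E) (g := G)
        (hG.differentiableAt (by simp)).hasFDerivAt (hasFDerivAt_prodMk_right _ _)
    have h2 : (fun Y : Fin s → E => G (0, Y)) = id := by
      funext Y i; simp [G]
    rw [h2] at h1
    exact h1.unique (hasFDerivAt_id _)
  have hinv : (fderiv ℝ G u₀ ∘L .inr ℝ ℝ (Fin s → E)).IsInvertible := by
    rw [hinr]; exact ⟨.refl ℝ _, rfl⟩
  let ψ := hG.implicitFunction one_ne_zero hinv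
  have hψ : Filter.Tendsto ψ (𝓝 0) (𝓝 fun _ => y₀) :=
    (hG.hasStrictFDerivAt one_ne_zero).tendsto_implicitFunctionOfProdDomain hinv
  have hsol : ∀ᶠ h in 𝓝 (0 : ℝ), G (h, ψ h) = G u₀ :=
    hG.eventually_apply_implicitFunction one_ne_zero hinv
  refine ⟨fun i h => ψ h i, fun h => y₀ + h • ∑ i, b i • f (ψ h i),
    fun i => (tendsto_pi_nhds.1 hψ) i, ?_, .of_forall fun _ => rfl⟩
  filter_upwards [hsol] with h hh i
  have := congrFun hh i
  simp only [G, u₀, zero_smul, sub_zero] at this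
  rw [← this, sub_add_cancel]

theorem exists_isExactSolution {E : Type} [NormedAddCommGroup E] [NormedSpace ℝ E]
    [CompleteSpace E] {f : E → E} {y₀ : E} (hf : ContDiffAt ℝ 1 f y₀) :
    ∃ y, IsExactSolution f y₀ y := by
  obtain ⟨y, h0, ε, hε, hy⟩ :=
    hf.exists_forall_mem_closedBall_exists_eq_forall_mem_Ioo_hasDerivAt₀ 0
  refine ⟨y, h0, ?_⟩
  filter_upwards [Ioo_mem_nhds (by linarith : (0 : ℝ) - ε < 0) (by linarith : 0 < 0 + ε)]
    using hy

/-! ### Expansions over plane trees -/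

/-- The plane trees with at most `n` vertices. -/
noncomputable def treesLE (n : ℕ) : Finset OrderedTree := (finite_order_le n).toFinset

theorem mem_treesLE {n : ℕ} {t : OrderedTree} : t ∈ treesLE n ↔ t.order ≤ n := by
  simp [treesLE]

theorem lt_order_node {l : ℕ} (c : Fin l → OrderedTree) : l < (node l c).order := by
  have : l ≤ ∑ i, (c i).order := by
    simpa using Finset.card_nsmul_le_sum Finset.univ (fun i => (c i).order) 1
      (fun i _ => one_le_order (c i))
  change l < 1 + ∑ i, (c i).order
  omega

theorem order_child_lt {l : ℕ} (c : Fin l → OrderedTree) (i : Fin l) :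
    (c i).order < (node l c).order := by
  have := Finset.single_le_sum (f := fun i => (c i).order) (fun _ _ => Nat.zero_le _)
    (Finset.mem_univ i)
  change (c i).order < 1 + ∑ i, (c i).order
  change (c i).order ≤ ∑ i, (c i).order at this
  omega

/-- The product of `1 / l!` over all vertices, `l` being the number of children: the weight with
which a plane tree enters when Taylor's formula is substituted into itself. -/
noncomputable def planeWeight : OrderedTree → ℝ
  | node l c => (l.factorial : ℝ)⁻¹ * ∏ i, planeWeight (c i)

/-- The coefficient of `h ^ (|T| - 1) T(f)(y₀)` in `f(y₀ + δ(h))`, when `x T` is the coefficient of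
`h ^ |T| T(f)(y₀)` in `δ(h)`. -/
noncomputable def childCoeff (x : OrderedTree → ℝ) : OrderedTree → ℝ
  | node l c => (l.factorial : ℝ)⁻¹ * ∏ i, x (c i)

/-- The B-series with coefficients `x`, truncated after the trees of order `q`. -/
noncomputable def bSeries {E : Type} [NormedAddCommGroup E] [NormedSpace ℝ E] (f : E → E) (y₀ : E)
    (x : OrderedTree → ℝ) (q : ℕ) (h : ℝ) : E :=
  ∑ t ∈ treesLE q, (h ^ t.order * x t) • t.network f y₀

theorem isBigO_pow_of_le {m n : ℕ} (hmn : m ≤ n) :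
    (fun h : ℝ => h ^ n) =O[𝓝 0] fun h : ℝ => h ^ m := by
  rcases hmn.eq_or_lt with rfl | hlt
  · exact isBigO_refl _ _
  · exact (isLittleO_pow_pow hlt).isBigO

theorem isBigO_pow_smul {E : Type} [NormedAddCommGroup E] [NormedSpace ℝ E]
    {m n : ℕ} (hmn : m ≤ n) (a : ℝ) (v : E) :
    (fun h : ℝ => (h ^ n * a) • v) =O[𝓝 0] fun h : ℝ => h ^ m := by
  refine IsBigO.trans ?_ (isBigO_pow_of_le hmn)
  refine IsBigO.of_bound (|a| * ‖v‖) (.of_forall fun h => ?_)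
  rw [norm_smul, norm_mul, Real.norm_eq_abs a]
  exact le_of_eq (by ring)

theorem isBigO_sum_smul {E ι : Type} [NormedAddCommGroup E] [NormedSpace ℝ E] {s : Finset ι}
    {g : ι → ℝ → E} {k : ℝ → ℝ} (a : ι → ℝ) (hg : ∀ j ∈ s, g j =O[𝓝 0] k) :
    (fun h => ∑ j ∈ s, a j • g j h) =O[𝓝 0] k := by
  refine IsBigO.fun_sum fun j hj => ?_
  exact (hg j hj).const_smul_left (a j)

theorem bSeries_isBigO {E : Type} [NormedAddCommGroup E] [NormedSpace ℝ E] (f : E → E) (y₀ : E)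
    (x : OrderedTree → ℝ) (q : ℕ) : bSeries f y₀ x q =O[𝓝 0] fun h : ℝ => h ^ 1 := by
  exact .fun_sum fun t _ => isBigO_pow_smul (one_le_order t) _ _

/-- An `l`-linear map sends two arguments of size `O(h)` that agree up to `O(h ^ n)` to values that
agree up to `O(h ^ n)`. -/
theorem multilinear_sub_isBigO {E F : Type} [NormedAddCommGroup E] [NormedSpace ℝ E]
    [NormedAddCommGroup F] [NormedSpace ℝ F] {l n : ℕ}
    (L : ContinuousMultilinearMap ℝ (fun _ : Fin l => E) F)
    {δ S : ℝ → E} (hδ : δ =O[𝓝 0] fun h : ℝ => h ^ 1) (hS : S =O[𝓝 0] fun h : ℝ => h ^ 1)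
    (hsub : (fun h => δ h - S h) =O[𝓝 0] fun h : ℝ => h ^ n) :
    (fun h => L (fun _ => δ h) - L (fun _ => S h)) =O[𝓝 0] fun h : ℝ => h ^ n := by
  have ht : Tendsto (fun h : ℝ => h ^ 1) (𝓝 0) (𝓝 0) := by
    simpa using (continuous_pow 1).tendsto (0 : ℝ)
  have b1 := (hδ.trans_tendsto ht).norm.eventually (gt_mem_nhds (by simp : ‖(0 : E)‖ < 1))
  have b2 := (hS.trans_tendsto ht).norm.eventually (gt_mem_nhds (by simp : ‖(0 : E)‖ < 1))
  refine IsBigO.trans ?_ hsub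
  refine IsBigO.of_bound (‖L‖ * l) ?_
  filter_upwards [b1, b2] with h h1 h2
  refine (L.norm_image_sub_le _ _).trans ?_
  have e1 : ‖(fun _ => δ h : Fin l → E)‖ ≤ 1 :=
    (pi_norm_le_iff_of_nonneg zero_le_one).2 fun _ => h1.le
  have e2 : ‖(fun _ => S h : Fin l → E)‖ ≤ 1 :=
    (pi_norm_le_iff_of_nonneg zero_le_one).2 fun _ => h2.le
  have e3 : ‖(fun _ => δ h : Fin l → E) - fun _ => S h‖ ≤ ‖δ h - S h‖ :=
    (pi_norm_le_iff_of_nonneg (norm_nonneg _)).2 fun _ => le_rfl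
  have e4 : max ‖(fun _ => δ h : Fin l → E)‖ ‖(fun _ => S h : Fin l → E)‖ ^
      (Fintype.card (Fin l) - 1) ≤ 1 :=
    pow_le_one₀ (le_max_of_le_left (norm_nonneg _)) (max_le e1 e2)
  rw [Fintype.card_fin] at e4 ⊢
  calc _ ≤ ‖L‖ * l * 1 * ‖δ h - S h‖ := by gcongr
    _ = _ := by ring

theorem node_injective : Function.Injective
    (fun p : Σ l : ℕ, (Fin l → OrderedTree) => node p.1 p.2) := by
  rintro ⟨l, c⟩ ⟨m, c₂⟩ h
  simp only [node.injEq] at h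
  obtain ⟨rfl, h⟩ := h
  rw [eq_of_heq h]

/-- Substituting a truncated B-series into the Taylor polynomial of `f` gives the sum over all
trees whose root has at most `q` children and whose root-subtrees have at most `q` vertices. -/
theorem taylor_bSeries {E : Type} [NormedAddCommGroup E] [NormedSpace ℝ E] (f : E → E) (y₀ : E)
    (x : OrderedTree → ℝ) (q : ℕ) (h : ℝ) :
    ∑ l ∈ Finset.range (q + 1), ((l.factorial : ℝ)⁻¹) •
        iteratedFDeriv ℝ l f y₀ (fun _ => bSeries f y₀ x q h) =
      ∑ p ∈ (Finset.range (q + 1)).sigma fun l => Fintype.piFinset fun _ : Fin l => treesLE q,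
        (h ^ ((node p.1 p.2).order - 1) * childCoeff x (node p.1 p.2)) •
          (node p.1 p.2).network f y₀ := by
  rw [Finset.sum_sigma]
  refine Finset.sum_congr rfl fun l _ => ?_
  unfold bSeries
  rw [ContinuousMultilinearMap.map_sum_finset, Finset.smul_sum]
  refine Finset.sum_congr rfl fun r _ => ?_
  rw [ContinuousMultilinearMap.map_smul_univ, smul_smul, Finset.prod_mul_distrib,
    Finset.prod_pow_eq_pow_sum]
  simp only [order, childCoeff, network, Nat.add_sub_cancel_left]
  congr 1
  ring

/-- If `δ` has a B-series up to order `q` with coefficients `x`, then `f(y₀ + δ)` has the expansion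
with coefficients `childCoeff x`, one order further (a tree contributes `h ^ (|T| - 1)`). -/
theorem comp_bSeries_isBigO {E : Type} [NormedAddCommGroup E] [NormedSpace ℝ E] [CompleteSpace E]
    {f : E → E} {y₀ : E} {q : ℕ} (hf : ContDiffAt ℝ (q + 1 : ℕ) f y₀) (x : OrderedTree → ℝ)
    {δ : ℝ → E} (hδ : (fun h => δ h - bSeries f y₀ x q h) =O[𝓝 0] fun h : ℝ => h ^ (q + 1)) :
    (fun h => f (y₀ + δ h) - ∑ t ∈ treesLE (q + 1),
      (h ^ (t.order - 1) * childCoeff x t) • t.network f y₀) =O[𝓝 0] fun h : ℝ => h ^ (q + 1) := by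
  classical
  have hS := bSeries_isBigO f y₀ x q
  have hδ1 : δ =O[𝓝 0] fun h : ℝ => h ^ 1 := by
    simpa using (hδ.trans (isBigO_pow_of_le (by omega))).add hS
  have hδ0 : Tendsto δ (𝓝 0) (𝓝 0) :=
    hδ1.trans_tendsto (by simpa using (continuous_pow 1).tendsto (0 : ℝ))
  have h1 : (fun h => f (y₀ + δ h) - ∑ l ∈ Finset.range (q + 1),
      ((l.factorial : ℝ)⁻¹) • iteratedFDeriv ℝ l f y₀ (fun _ => δ h)) =O[𝓝 0]
      fun h : ℝ => h ^ (q + 1) := by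
    refine ((taylor_isBigO hf).comp_tendsto hδ0).trans ?_
    simpa [Function.comp_def] using hδ1.norm_left.pow (q + 1)
  have h2 : (fun h => ∑ l ∈ Finset.range (q + 1),
      ((l.factorial : ℝ)⁻¹) • iteratedFDeriv ℝ l f y₀ (fun _ => δ h) -
      ∑ l ∈ Finset.range (q + 1), ((l.factorial : ℝ)⁻¹) •
        iteratedFDeriv ℝ l f y₀ (fun _ => bSeries f y₀ x q h)) =O[𝓝 0]
      fun h : ℝ => h ^ (q + 1) := by
    simp only [← Finset.sum_sub_distrib, ← smul_sub]
    exact isBigO_sum_smul _ fun l _ => multilinear_sub_isBigO _ hδ1 hS hδ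
  have h3 : (fun h => ∑ l ∈ Finset.range (q + 1), ((l.factorial : ℝ)⁻¹) •
        iteratedFDeriv ℝ l f y₀ (fun _ => bSeries f y₀ x q h) -
      ∑ t ∈ treesLE (q + 1), (h ^ (t.order - 1) * childCoeff x t) • t.network f y₀) =O[𝓝 0]
      fun h : ℝ => h ^ (q + 1) := by
    simp only [taylor_bSeries]
    set P := (Finset.range (q + 1)).sigma fun l => Fintype.piFinset fun _ : Fin l => treesLE q
    have hsub : treesLE (q + 1) ⊆ P.image fun p => node p.1 p.2 := by
      rintro ⟨l, c⟩ ht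
      rw [mem_treesLE] at ht
      refine Finset.mem_image.2 ⟨⟨l, c⟩, Finset.mem_sigma.2
        ⟨Finset.mem_range.2 ((lt_order_node c).trans_le ht), Fintype.mem_piFinset.2 fun i => ?_⟩,
        rfl⟩
      exact mem_treesLE.2 (Nat.lt_succ_iff.1 ((order_child_lt c i).trans_le ht))
    -- The trees with more than `q + 1` vertices that the substitution produces are absorbed by the
    -- remainder.
    have hP : ∀ h : ℝ, ∑ p ∈ P, (h ^ ((node p.1 p.2).order - 1) * childCoeff x (node p.1 p.2)) •
          (node p.1 p.2).network f y₀ -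
        ∑ t ∈ treesLE (q + 1), (h ^ (t.order - 1) * childCoeff x t) • t.network f y₀ =
        ∑ t ∈ P.image (fun p => node p.1 p.2) \ treesLE (q + 1),
          (h ^ (t.order - 1) * childCoeff x t) • t.network f y₀ := by
      intro h
      rw [sub_eq_iff_eq_add, Finset.sum_sdiff hsub, Finset.sum_image node_injective.injOn]
    simp only [hP]
    refine .fun_sum fun t ht => isBigO_pow_smul ?_ _ _
    rw [Finset.mem_sdiff, mem_treesLE] at ht
    omega
  simpa using (h1.add h2).add h3

theorem smul_sum_childCoeff {E : Type} [NormedAddCommGroup E] [NormedSpace ℝ E] (f : E → E)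
    (y₀ : E) (x : OrderedTree → ℝ) (q : ℕ) (h : ℝ) :
    h • ∑ t ∈ treesLE q, (h ^ (t.order - 1) * childCoeff x t) • t.network f y₀ =
      bSeries f y₀ (childCoeff x) q h := by
  rw [bSeries, Finset.smul_sum]
  refine Finset.sum_congr rfl fun t _ => ?_
  rw [smul_smul, ← mul_assoc, ← pow_succ', Nat.sub_add_cancel (one_le_order t)]

theorem bSeries_zero {E : Type} [NormedAddCommGroup E] [NormedSpace ℝ E] (f : E → E) (y₀ : E)
    (x : OrderedTree → ℝ) (h : ℝ) : bSeries f y₀ x 0 h = 0 := by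
  refine Finset.sum_eq_zero fun t ht => ?_
  have := one_le_order t
  rw [mem_treesLE] at ht
  omega

/-- The stage equations at the level of coefficients: `h A f(Y)` has the same coefficients as
`Y - y₀`. -/
theorem sum_smul_bSeries_childCoeff {E : Type} [NormedAddCommGroup E] [NormedSpace ℝ E]
    {ι : Type} [Fintype ι] (A : Matrix ι ι ℝ) (f : E → E) (y₀ : E) (q : ℕ) (i : ι) (h : ℝ) :
    ∑ j, A i j • bSeries f y₀ (childCoeff fun t => planeWeight t * t.stageVector A j) q h =
      bSeries f y₀ (fun t => planeWeight t * t.stageVector A i) q h := by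
  simp only [bSeries, Finset.smul_sum, smul_smul]
  rw [Finset.sum_comm]
  refine Finset.sum_congr rfl fun t _ => ?_
  rw [← Finset.sum_smul]
  congr 1
  obtain ⟨l, c⟩ := t
  simp only [childCoeff, planeWeight, stageVector, Finset.prod_mul_distrib, Finset.mul_sum]
  exact Finset.sum_congr rfl fun j _ => by ring

/-- B-series of the stages of a Runge-Kutta method: the coefficient of the plane tree `T` is the
contraction of its network, times `planeWeight T`. -/
theorem stage_sub_bSeries_isBigO {E : Type} [NormedAddCommGroup E] [NormedSpace ℝ E]
    [CompleteSpace E] {ι : Type} [Fintype ι] {A : Matrix ι ι ℝ} {f : E → E} {y₀ : E} {p : ℕ}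
    (hf : ContDiffAt ℝ p f y₀) {Y : ι → ℝ → E} (hY : ∀ i, Tendsto (Y i) (𝓝 0) (𝓝 y₀))
    (hstage : ∀ᶠ h in 𝓝 (0 : ℝ), ∀ i, Y i h = y₀ + h • ∑ j, A i j • f (Y j h))
    {q : ℕ} (hq : q ≤ p) (i : ι) :
    (fun h => Y i h - y₀ - bSeries f y₀ (fun t => planeWeight t * t.stageVector A i) q h) =O[𝓝 0]
      fun h : ℝ => h ^ (q + 1) := by
  induction q generalizing i with
  | zero =>
    simp only [bSeries_zero, sub_zero]
    have hfb : ∀ j, (fun h => f (Y j h)) =O[𝓝 0] fun _ : ℝ => (1 : ℝ) := fun j =>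
      (hf.continuousAt.tendsto.comp (hY j)).isBigO_one ℝ
    have hsum : (fun h => ∑ j, A i j • f (Y j h)) =O[𝓝 0] fun _ : ℝ => (1 : ℝ) :=
      isBigO_sum_smul _ fun j _ => hfb j
    refine (((isBigO_refl (fun h : ℝ => h) (𝓝 0)).smul hsum).congr' ?_ ?_)
    · filter_upwards [hstage] with h hh
      conv_rhs => rw [hh i]
      rw [add_sub_cancel_left]
    · exact .of_forall fun h => by simp
  | succ q ih =>
    have ih := ih (by omega)
    have hcomp := fun j => comp_bSeries_isBigO
      (δ := fun h => Y j h - y₀) (hf.of_le (by exact_mod_cast hq)) _ (ih j)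
    have hsum := isBigO_sum_smul (s := Finset.univ) (A i) fun j _ => hcomp j
    refine (((isBigO_refl (fun h : ℝ => h) (𝓝 0)).smul hsum).congr' ?_ ?_)
    · filter_upwards [hstage] with h hh
      conv_rhs => rw [hh i]
      rw [add_sub_cancel_left]
      simp only [add_sub_cancel, smul_sub, Finset.sum_sub_distrib]
      rw [← sum_smul_bSeries_childCoeff A f y₀ (q + 1) i h]
      simp only [← smul_sum_childCoeff, smul_comm (A i _) h, ← Finset.smul_sum]
    · exact .of_forall fun h => by simp [pow_succ' h (q + 1)]

/-- B-series of the exact solution: the coefficient of the plane tree `T` is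
`planeWeight T / γ(T)`. -/
theorem exact_sub_bSeries_isBigO {E : Type} [NormedAddCommGroup E] [NormedSpace ℝ E]
    [CompleteSpace E] {f : E → E} {y₀ : E} {p : ℕ}
    (hf : ContDiffAt ℝ p f y₀) {y : ℝ → E} (hy : IsExactSolution f y₀ y) {q : ℕ} (hq : q ≤ p) :
    (fun h => y h - y₀ - bSeries f y₀ (fun t => planeWeight t * (t.gamma : ℝ)⁻¹) q h) =O[𝓝 0]
      fun h : ℝ => h ^ (q + 1) := by
  obtain ⟨h0, hderiv⟩ := hy
  induction q with
  | zero =>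
    simp only [bSeries_zero, sub_zero]
    refine isBigO_pow_succ_of_hasDerivAt (R' := fun h => f (y h)) (by simp [h0]) ?_ ?_
    · filter_upwards [hderiv] with t ht using ht.sub_const _
    · have hc : ContinuousAt y 0 := hderiv.self_of_nhds.continuousAt
      have : Tendsto (fun h => f (y h)) (𝓝 0) (𝓝 (f y₀)) :=
        Tendsto.comp hf.continuousAt.tendsto (h0 ▸ hc.tendsto)
      simpa using this.isBigO_one ℝ
  | succ q ih =>
    have ih := ih (by omega)
    have hcomp := comp_bSeries_isBigO
      (δ := fun h => y h - y₀) (hf.of_le (by exact_mod_cast hq)) _ ih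
    refine isBigO_pow_succ_of_hasDerivAt ?_ ?_ hcomp
    · have : bSeries f y₀ (fun t => planeWeight t * (t.gamma : ℝ)⁻¹) (q + 1) 0 = 0 := by
        refine Finset.sum_eq_zero fun t _ => ?_
        rw [zero_pow (by have := one_le_order t; omega), zero_mul, zero_smul]
      simp [h0, this]
    · filter_upwards [hderiv] with h hh
      simp only [add_sub_cancel]
      refine (hh.sub_const _).sub ?_
      unfold bSeries
      refine HasDerivAt.fun_sum fun t _ => ?_
      have h1 := ((hasDerivAt_pow t.order h).mul_const
        (planeWeight t * (t.gamma : ℝ)⁻¹)).smul_const (t.network f y₀)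
      convert! h1 using 2
      -- The coefficients agree because `γ(T) = |T| ∏ γ(Tᵢ)`.
      obtain ⟨l, c⟩ := t
      have hne : (((node l c).order : ℕ) : ℝ) ≠ 0 := by
        have := one_le_order (node l c)
        exact_mod_cast (by omega : (node l c).order ≠ 0)
      simp only [childCoeff, planeWeight, gamma, Finset.prod_mul_distrib, Nat.cast_mul,
        Nat.cast_prod, mul_inv, Finset.prod_inv_distrib]
      field_simp

/-! ### From plane trees to rooted trees -/

/-- The unlabelled rooted tree underlying a plane tree. -/
def toRooted (t : OrderedTree) : RootedTree := Quotient.mk setoid t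

theorem toRooted_eq_iff {t u : OrderedTree} : toRooted t = toRooted u ↔ Iso t u :=
  Quotient.eq (r := setoid)

theorem toRooted_surjective : Function.Surjective toRooted := Quotient.exists_rep

/-- `T(f)` does not depend on the ordering of the children, at points where `f` is smooth enough
for its derivatives to be symmetric. -/
theorem network_congr {E : Type} [NormedAddCommGroup E] [NormedSpace ℝ E] {f : E → E} {y : E}
    {p : ℕ} (hf : ContDiffAt ℝ p f y) {t u : OrderedTree} (h : Iso t u) (ht : t.order ≤ p) :
    t.network f y = u.network f y := by
  induction h with
  | @node l c c₂ e h ih =>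
    have hc : ∀ i, (c i).network f y = (c₂ (e i)).network f y := fun i =>
      ih i ((order_child_lt c i).le.trans ht)
    simp only [network, hc]
    exact iteratedFDeriv_comp_perm (hf.of_le (by exact_mod_cast (lt_order_node c).le.trans ht)) e
      fun i => (c₂ i).network f y

theorem network_toRooted {E : Type} [NormedAddCommGroup E] [NormedSpace ℝ E] {f : E → E} {y : E}
    {p : ℕ} (hf : ContDiffAt ℝ p f y) {t : OrderedTree} (ht : t.order ≤ p) :
    (toRooted t).network f y = t.network f y :=
  (network_congr hf (toRooted_eq_iff.1 (Quotient.out_eq (toRooted t)).symm) ht).symm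

/-- The plane trees that represent a given rooted tree. -/
noncomputable def planeReps (T : RootedTree) : Finset OrderedTree :=
  (((finite_order_le T.order).subset fun t (ht : toRooted t = T) => by
    subst ht; exact le_refl t.order : {t | toRooted t = T}.Finite)).toFinset

theorem mem_planeReps {T : RootedTree} {t : OrderedTree} :
    t ∈ planeReps T ↔ toRooted t = T := by
  simp [planeReps]

theorem toRooted_node_eq_iff {l : ℕ} (c c₂ : Fin l → OrderedTree) :
    toRooted (node l c₂) = toRooted (node l c) ↔
      ∃ e : Equiv.Perm (Fin l), (fun i => toRooted (c₂ i)) =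
        (fun i => toRooted (c i)) ∘ e := by
  constructor
  · intro h
    have h : Iso (node l c₂) (node l c) := toRooted_eq_iff.1 h
    cases h with
    | node e h => exact ⟨e, funext fun i => toRooted_eq_iff.2 (h i)⟩
  · rintro ⟨e, h⟩
    exact toRooted_eq_iff.2 (Iso.node e fun i => toRooted_eq_iff.1 (congrFun h i))

open Classical in
/-- The orbit-stabilizer count of the distinct reorderings of a family, the stabilizer being a
product of symmetric groups of the fibres. -/
theorem card_reorderings_mul {α : Type} {l : ℕ} (C : Fin l → α) :
    (Finset.univ.image fun e : Equiv.Perm (Fin l) => C ∘ e).card *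
      ∏ a ∈ Finset.univ.image C, (Finset.univ.filter fun i => C i = a).card.factorial =
      l.factorial := by
  have hstab : (Finset.univ.filter fun e : Equiv.Perm (Fin l) => C ∘ e = C).card =
      ∏ a ∈ Finset.univ.image C, (Finset.univ.filter fun i => C i = a).card.factorial := by
    have := DomMulAct.stabilizer_card' C
    simp only [Fintype.card_subtype] at this
    exact this
  rw [← hstab]
  -- All fibres of `e ↦ C ∘ e` over its image are translates of the stabilizer of `C`.
  have hfib : ∀ D ∈ Finset.univ.image fun e : Equiv.Perm (Fin l) => C ∘ e,
      (Finset.univ.filter fun e : Equiv.Perm (Fin l) => C ∘ e = D).card =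
      (Finset.univ.filter fun e : Equiv.Perm (Fin l) => C ∘ e = C).card := by
    intro D hD
    obtain ⟨e₀, -, rfl⟩ := Finset.mem_image.1 hD
    refine Finset.card_bij (fun e _ => e * e₀⁻¹) ?_ ?_ ?_
    · intro e he
      rw [Finset.mem_filter] at he ⊢
      refine ⟨Finset.mem_univ _, funext fun i => ?_⟩
      simpa using congrFun he.2 (e₀⁻¹ i)
    · intro e _ e₂ _ h
      exact mul_right_cancel h
    · intro e he
      rw [Finset.mem_filter] at he
      refine ⟨e * e₀, ?_, by simp⟩
      rw [Finset.mem_filter]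
      refine ⟨Finset.mem_univ _, funext fun i => ?_⟩
      simpa using congrFun he.2 (e₀ i)
  have := Finset.card_eq_sum_card_image (fun e : Equiv.Perm (Fin l) => C ∘ e) Finset.univ
  rw [Finset.sum_congr rfl hfib, Finset.sum_const, smul_eq_mul, Finset.card_univ,
    Fintype.card_perm, Fintype.card_fin] at this
  exact this.symm

open Classical in
/-- A plane representative of `[c₀, ..., c₍ₗ₋₁₎]` is a reordering of the classes of the children
together with a plane representative of each of them. -/
theorem planeReps_node {l : ℕ} (c : Fin l → OrderedTree) :
    planeReps (toRooted (node l c)) =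
      ((Finset.univ.image fun e : Equiv.Perm (Fin l) => (fun i => toRooted (c i)) ∘ e).sigma
        fun D => Fintype.piFinset fun i => planeReps (D i)).image fun p => node l p.2 := by
  ext t
  simp only [mem_planeReps, Finset.mem_image, Finset.mem_sigma, Finset.mem_univ, true_and,
    Fintype.mem_piFinset]
  constructor
  · intro h
    obtain ⟨m, c₂⟩ := t
    obtain rfl : m = l := by
      have h : Iso (node m c₂) (node l c) := toRooted_eq_iff.1 h
      cases h; rfl
    obtain ⟨e, he⟩ := (toRooted_node_eq_iff c c₂).1 h
    exact ⟨⟨_, c₂⟩, ⟨⟨e, rfl⟩, fun i => congrFun he i⟩, rfl⟩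
  · rintro ⟨⟨D, r⟩, ⟨⟨e, rfl⟩, hr⟩, rfl⟩
    exact (toRooted_node_eq_iff c r).2 ⟨e, funext hr⟩

open Classical in
theorem sigma_toRooted_node {l : ℕ} (c : Fin l → OrderedTree) :
    (toRooted (node l c)).sigma = (∏ i, (c i).sigma) *
      ∏ a ∈ Finset.univ.image fun i => toRooted (c i),
        (Finset.univ.filter fun i => toRooted (c i) = a).card.factorial := by
  change OrderedTree.sigma (node l c) = _
  rw [OrderedTree.sigma]
  congr 1
  -- The two sides differ only in the decidability instances.
  refine Finset.prod_congr ?_ fun C _ => congrArg (fun s => (Finset.card s).factorial) ?_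
  · ext C
    exact Finset.mem_image.trans
      (Finset.mem_image (f := fun i => toRooted (c i)) (s := Finset.univ) (b := C)).symm
  · ext i
    exact Finset.mem_filter.trans (Finset.mem_filter (p := fun i => toRooted (c i) = C)).symm

/-- The weights of the plane trees representing `T` add up to `1 / σ(T)`. -/
theorem sum_planeWeight_planeReps (T : RootedTree) :
    ∑ t ∈ planeReps T, planeWeight t = (T.sigma : ℝ)⁻¹ := by
  classical
  obtain ⟨t, rfl⟩ := toRooted_surjective T
  induction t with
  | node l c ih =>
    rw [planeReps_node, Finset.sum_image]
    set C : Fin l → RootedTree := fun i => toRooted (c i)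
    · rw [Finset.sum_sigma]
      -- The inner sum factorizes over the children and is the same for all reorderings.
      have hD : ∀ D ∈ Finset.univ.image (fun e : Equiv.Perm (Fin l) => C ∘ e),
          ∑ r ∈ Fintype.piFinset (fun i => planeReps (D i)), planeWeight (node l r) =
          (l.factorial : ℝ)⁻¹ * ∏ i, ((c i).sigma : ℝ)⁻¹ := by
        intro D hD
        obtain ⟨e, -, rfl⟩ := Finset.mem_image.1 hD
        simp only [planeWeight, ← Finset.mul_sum]
        rw [← Finset.prod_univ_sum (fun i => planeReps ((C ∘ e) i)) fun _ t => planeWeight t]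
        have : ∀ i, ∑ t ∈ planeReps ((C ∘ e) i), planeWeight t = ((c (e i)).sigma : ℝ)⁻¹ :=
          fun i => ih (e i)
        simp only [this]
        rw [Equiv.prod_comp e fun i => ((c i).sigma : ℝ)⁻¹]
      rw [Finset.sum_congr rfl hD, Finset.sum_const, nsmul_eq_mul]
      have hcard := card_reorderings_mul C
      rw [sigma_toRooted_node, ← hcard]
      set N := (Finset.univ.image fun e : Equiv.Perm (Fin l) => C ∘ e).card
      have hN : (N : ℝ) ≠ 0 := by
        intro h0
        rw [Nat.cast_eq_zero] at h0
        rw [h0, zero_mul] at hcard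
        exact Nat.factorial_ne_zero _ hcard.symm
      push_cast
      rw [Finset.prod_inv_distrib]
      simp only [mul_inv]
      field_simp
      rfl
    · rintro ⟨D, r⟩ h ⟨D₂, r₂⟩ h₂ heq
      simp only [Finset.coe_sigma, Set.mem_sigma_iff, Finset.mem_coe, Fintype.mem_piFinset,
        mem_planeReps] at h h₂
      simp only [node.injEq, heq_eq_eq, true_and] at heq
      subst heq
      obtain rfl : D = D₂ := funext fun i => (h.2 i).symm.trans (h₂.2 i)
      rfl

open Classical in
/-- Collecting the plane trees of order `j` in a sum into rooted trees. -/
theorem sum_planeWeight_smul {E : Type} [AddCommGroup E] [Module ℝ E] {p j : ℕ} (hj : j ≤ p)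
    (g : RootedTree → E) :
    ∑ t ∈ (treesLE p).filter (fun t => t.order = j),
        planeWeight t • g (toRooted t) =
      ∑ T : TreeOfOrder j, (T.1.sigma : ℝ)⁻¹ • g T.1 := by
  have hfil : (treesLE p).filter (fun t => t.order = j) =
      (Finset.univ : Finset (TreeOfOrder j)).biUnion fun T => planeReps T.1 := by
    ext t
    simp only [Finset.mem_filter, mem_treesLE, Finset.mem_biUnion, Finset.mem_univ, true_and,
      mem_planeReps]
    constructor
    · rintro ⟨-, h⟩
      exact ⟨⟨toRooted t, h⟩, rfl⟩
    · rintro ⟨⟨T, hT⟩, h⟩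
      subst h
      have hT : t.order = j := hT
      exact ⟨hT ▸ hj, hT⟩
  rw [hfil, Finset.sum_biUnion]
  · refine Finset.sum_congr rfl fun T _ => ?_
    rw [← sum_planeWeight_planeReps, Finset.sum_smul]
    exact Finset.sum_congr rfl fun t ht => by rw [mem_planeReps.1 ht]
  · intro T _ T₂ _ hne
    refine Finset.disjoint_left.2 fun t ht ht₂ => hne (Subtype.ext ?_)
    exact (mem_planeReps.1 ht).symm.trans (mem_planeReps.1 ht₂)

/-! ### Order conditions -/

/-- A polynomial of degree at most `p` in `h` is `O(h ^ (p + 1))` at `0` only if it vanishes. -/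
theorem sum_pow_smul_isBigO_iff {E : Type} [NormedAddCommGroup E] [NormedSpace ℝ E] (p : ℕ)
    (v : ℕ → E) :
    (fun h : ℝ => ∑ j ∈ Finset.range (p + 1), h ^ j • v j) =O[𝓝 0] (fun h : ℝ => h ^ (p + 1)) ↔
      ∀ j ≤ p, v j = 0 := by
  constructor
  · intro hO j
    induction j using Nat.strong_induction_on with
    | _ j ih =>
      intro hj
      have hsplit : ∀ h : ℝ, ∑ i ∈ Finset.range (p + 1), h ^ i • v i =
          h ^ j • v j + ∑ i ∈ Finset.Ico (j + 1) (p + 1), h ^ i • v i := by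
        intro h
        rw [← Finset.sum_range_add_sum_Ico _ (by omega : j + 1 ≤ p + 1), Finset.sum_range_succ,
          Finset.sum_eq_zero fun i hi => ?_, zero_add]
        rw [Finset.mem_range] at hi
        rw [ih i hi (by omega), smul_zero]
      have htail : (fun h : ℝ => ∑ i ∈ Finset.Ico (j + 1) (p + 1), h ^ i • v i) =O[𝓝 0]
          fun h : ℝ => h ^ (j + 1) :=
        .fun_sum fun i hi => by
          simpa using isBigO_pow_smul (Finset.mem_Ico.1 hi).1 1 (v i)
      have h1 : (fun h : ℝ => h ^ j • v j) =O[𝓝 0] fun h : ℝ => h ^ (j + 1) := by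
        refine ((hO.trans (isBigO_pow_of_le (by omega))).sub htail).congr_left fun h => ?_
        rw [hsplit, add_sub_cancel_right]
      obtain ⟨C, hC⟩ := h1.bound
      -- Cancelling `h ^ j` leaves `‖v j‖ ≤ C |h|` for small nonzero `h`.
      have h2 : ∀ᶠ h in 𝓝[≠] (0 : ℝ), ‖v j‖ ≤ C * ‖h‖ := by
        filter_upwards [nhdsWithin_le_nhds hC, self_mem_nhdsWithin] with h hh hne
        rw [norm_smul, norm_pow, norm_pow, pow_succ] at hh
        have hpos : 0 < ‖h‖ ^ j := pow_pos (norm_pos_iff.2 hne) j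
        refine le_of_mul_le_mul_left ?_ hpos
        linarith
      have h3 : Tendsto (fun h : ℝ => C * ‖h‖) (𝓝[≠] 0) (𝓝 0) := by
        have : Continuous fun h : ℝ => C * ‖h‖ := by fun_prop
        simpa using (this.tendsto 0).mono_left nhdsWithin_le_nhds
      exact norm_le_zero_iff.1 (ge_of_tendsto h3 h2)
  · intro h0
    refine (isBigO_zero _ _).congr_left fun h => (Finset.sum_eq_zero fun j hj => ?_).symm
    rw [h0 j (by simpa [Nat.lt_succ_iff] using hj), smul_zero]

theorem sigma_pos (t : OrderedTree) : 0 < t.sigma := by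
  induction t with
  | node l c ih =>
    rw [OrderedTree.sigma]
    exact Nat.mul_pos (Finset.prod_pos fun i _ => ih i)
      (Finset.prod_pos fun _ _ => Nat.factorial_pos _)

theorem gamma_pos (t : OrderedTree) : 0 < t.gamma := by
  induction t with
  | node l c ih =>
    rw [OrderedTree.gamma]
    exact Nat.mul_pos (one_le_order _) (Finset.prod_pos fun i _ => ih i)

/-- The difference of two B-series, sorted by powers of `h` and collected into rooted trees. -/
theorem bSeries_sub_bSeries {E : Type} [NormedAddCommGroup E] [NormedSpace ℝ E] {f : E → E}
    {y₀ : E} {p : ℕ} (hf : ContDiffAt ℝ p f y₀) (x z : RootedTree → ℝ) (h : ℝ) :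
    bSeries f y₀ (fun t => planeWeight t * x (toRooted t)) p h -
      bSeries f y₀ (fun t => planeWeight t * z (toRooted t)) p h =
      ∑ j ∈ Finset.range (p + 1), h ^ j • ∑ T : TreeOfOrder j,
        (T.1.sigma : ℝ)⁻¹ • (x T.1 - z T.1) • T.1.network f y₀ := by
  classical
  rw [bSeries, bSeries, ← Finset.sum_sub_distrib,
    ← Finset.sum_fiberwise_of_maps_to (t := Finset.range (p + 1)) (g := OrderedTree.order)
      fun t ht => Finset.mem_range.2 (Nat.lt_succ_of_le (mem_treesLE.1 ht))]
  refine Finset.sum_congr rfl fun j hj => ?_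
  rw [← sum_planeWeight_smul (Nat.lt_succ_iff.1 (Finset.mem_range.1 hj))
    fun T => (x T - z T) • T.network f y₀, Finset.smul_sum]
  refine Finset.sum_congr rfl fun t ht => ?_
  rw [Finset.mem_filter, mem_treesLE] at ht
  rw [network_toRooted hf ht.1, ht.2, ← sub_smul, smul_smul, smul_smul]
  congr 1
  ring

/-- The new value of a Runge-Kutta step is the last stage of the augmented method. -/
theorem update_sub_bSeries_isBigO {E : Type} [NormedAddCommGroup E] [NormedSpace ℝ E]
    [CompleteSpace E] {s : ℕ} {A : Matrix (Fin s) (Fin s) ℝ} {b : Fin s → ℝ} {f : E → E} {y₀ : E}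
    {p : ℕ} (hf : ContDiffAt ℝ p f y₀) {Y : Fin s → ℝ → E} {y₁ : ℝ → E}
    (hstep : IsStep A b f y₀ Y y₁) :
    (fun h => y₁ h - y₀ - bSeries f y₀
      (fun t => planeWeight t * phi A b (toRooted t)) p h) =O[𝓝 0]
      fun h : ℝ => h ^ (p + 1) := by
  have hlim : Tendsto y₁ (𝓝 0) (𝓝 y₀) := by
    have h1 : Tendsto (fun h : ℝ => y₀ + h • ∑ i, b i • f (Y i h)) (𝓝 0)
        (𝓝 (y₀ + (0 : ℝ) • ∑ i, b i • f y₀)) :=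
      tendsto_const_nhds.add (tendsto_id.smul (tendsto_finsetSum _ fun i _ =>
        (hf.continuousAt.tendsto.comp (hstep.tendsto_stage i)).const_smul (b i)))
    rw [zero_smul, add_zero] at h1
    exact h1.congr' (hstep.update.mono fun h hh => hh.symm)
  refine stage_sub_bSeries_isBigO (A := augmented A b) (Y := Sum.elim Y fun _ => y₁) hf ?_ ?_
    le_rfl (Sum.inr ())
  · rintro (i | i)
    · exact hstep.tendsto_stage i
    · exact hlim
  · filter_upwards [hstep.stage, hstep.update] with h h1 h2
    rintro (i | i)
    · simpa [augmented] using h1 i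
    · simpa [augmented] using h2

/-- The defect of the order conditions at order `j`, as a function on `Ω`. -/
noncomputable def orderDefect {E : Type} [NormedAddCommGroup E] [NormedSpace ℝ E] {s : ℕ}
    (A : Matrix (Fin s) (Fin s) ℝ) (b : Fin s → ℝ) (f : E → E) (Ω : Set E) (j : ℕ) : Ω → E :=
  ∑ T : TreeOfOrder j, (T.1.alpha * (1 - T.1.gamma * phi A b T.1)) • networkOn f Ω T.1

theorem sum_sigma_smul_eq_orderDefect {E : Type} [NormedAddCommGroup E] [NormedSpace ℝ E] {s : ℕ}
    (A : Matrix (Fin s) (Fin s) ℝ) (b : Fin s → ℝ) (f : E → E) {Ω : Set E} (j : ℕ) (y : Ω) :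
    ∑ T : TreeOfOrder j, (T.1.sigma : ℝ)⁻¹ • (phi A b T.1 - (T.1.gamma : ℝ)⁻¹) •
      T.1.network f y = -((j.factorial : ℝ)⁻¹ • orderDefect A b f Ω j y) := by
  rw [orderDefect, Finset.sum_apply, Finset.smul_sum, ← Finset.sum_neg_distrib]
  refine Finset.sum_congr rfl fun T _ => ?_
  obtain ⟨T, rfl⟩ := T
  rw [Pi.smul_apply, networkOn, smul_smul, smul_smul, ← neg_smul]
  congr 1
  have hσ : (T.sigma : ℝ) ≠ 0 := by
    obtain ⟨t, rfl⟩ := toRooted_surjective T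
    exact Nat.cast_ne_zero.2 (sigma_pos t).ne'
  have hγ : (T.gamma : ℝ) ≠ 0 := by
    obtain ⟨t, rfl⟩ := toRooted_surjective T
    exact Nat.cast_ne_zero.2 (gamma_pos t).ne'
  have hj : (T.order.factorial : ℝ) ≠ 0 := Nat.cast_ne_zero.2 (Nat.factorial_ne_zero _)
  rw [RootedTree.alpha]
  field_simp
  ring

/-- The local error is minus the polynomial with coefficients `orderDefect / j!`, up to
`O(h ^ (p + 1))`. -/
theorem local_error_isBigO_iff {E : Type} [NormedAddCommGroup E] [NormedSpace ℝ E]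
    [CompleteSpace E] {s : ℕ} {A : Matrix (Fin s) (Fin s) ℝ} {b : Fin s → ℝ} {f : E → E}
    {Ω : Set E} {p : ℕ} (y₀ : Ω) (hf : ContDiffAt ℝ p f y₀) {y : ℝ → E} {Y : Fin s → ℝ → E}
    {y₁ : ℝ → E} (hy : IsExactSolution f y₀ y) (hstep : IsStep A b f y₀ Y y₁) :
    (fun h => y₁ h - y h) =O[𝓝 (0 : ℝ)] (fun h => h ^ (p + 1)) ↔
      ∀ j ≤ p, orderDefect A b f Ω j y₀ = 0 := by
  have h1 := (update_sub_bSeries_isBigO hf hstep).sub (exact_sub_bSeries_isBigO hf hy le_rfl)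
  have h2 : (fun h => y₁ h - y h - ∑ j ∈ Finset.range (p + 1), h ^ j • ∑ T : TreeOfOrder j,
      (T.1.sigma : ℝ)⁻¹ • (phi A b T.1 - (T.1.gamma : ℝ)⁻¹) • T.1.network f y₀) =O[𝓝 0]
      fun h : ℝ => h ^ (p + 1) := by
    refine h1.congr_left fun h => ?_
    rw [← bSeries_sub_bSeries hf (phi A b) fun T => (T.gamma : ℝ)⁻¹]
    change _ = y₁ h - y h - (_ - bSeries f y₀ (fun t => planeWeight t * (t.gamma : ℝ)⁻¹) p h)
    abel
  have h3 : (fun h => y₁ h - y h) =O[𝓝 (0 : ℝ)] (fun h => h ^ (p + 1)) ↔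
      (fun h : ℝ => ∑ j ∈ Finset.range (p + 1), h ^ j • ∑ T : TreeOfOrder j,
      (T.1.sigma : ℝ)⁻¹ • (phi A b T.1 - (T.1.gamma : ℝ)⁻¹) • T.1.network f y₀) =O[𝓝 0]
      fun h : ℝ => h ^ (p + 1) :=
    ⟨fun h => (h.sub h2).congr_left fun _ => sub_sub_cancel _ _,
      fun h => (h2.add h).congr_left fun _ => sub_add_cancel _ _⟩
  rw [h3, sum_pow_smul_isBigO_iff]
  refine forall₂_congr fun j _ => ?_
  rw [sum_sigma_smul_eq_orderDefect, neg_eq_zero, smul_eq_zero]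
  simp [Nat.factorial_ne_zero]

theorem hasOrder_iff_orderDefect {E : Type} [NormedAddCommGroup E] [NormedSpace ℝ E]
    [CompleteSpace E] {s : ℕ} {A : Matrix (Fin s) (Fin s) ℝ} {b : Fin s → ℝ} {f : E → E}
    {Ω : Set E} {p : ℕ} (hp : 1 ≤ p) (hf : ∀ y ∈ Ω, ContDiffAt ℝ p f y) :
    HasOrder A b f Ω p ↔ ∀ j ≤ p, orderDefect A b f Ω j = 0 := by
  have hf1 : ∀ y ∈ Ω, ContDiffAt ℝ 1 f y := fun y hy => (hf y hy).of_le (by exact_mod_cast hp)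
  constructor
  · intro h j hj
    funext y₀
    obtain ⟨⟨y, hy⟩, ⟨Y, y₁, hstep⟩, hO⟩ := h y₀ y₀.2
    exact (local_error_isBigO_iff y₀ (hf y₀ y₀.2) hy hstep).1 (hO y Y y₁ hy hstep) j hj
  · intro h y₀ hy₀
    refine ⟨exists_isExactSolution (hf1 y₀ hy₀), exists_isStep A b (hf1 y₀ hy₀), ?_⟩
    intro y Y y₁ hy hstep
    exact (local_error_isBigO_iff ⟨y₀, hy₀⟩ (hf y₀ hy₀) hy hstep).2 fun j hj => by
      rw [h j hj, Pi.zero_apply]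

/-- The matrix condition says, in coordinates with respect to the basis `B`, that `orderDefect`
vanishes; in particular it does not depend on the basis. -/
theorem vecMul_eq_iff_orderDefect {E : Type} [NormedAddCommGroup E] [NormedSpace ℝ E] {s : ℕ}
    (A : Matrix (Fin s) (Fin s) ℝ) (b : Fin s → ℝ) {f : E → E} {Ω : Set E} {j n : ℕ}
    {B : Module.Basis (Fin n) ℝ (networkSpan f Ω j)} {M : Matrix (Fin n) (TreeOfOrder j) ℝ}
    (hM : Expresses f Ω j B M) :
    alphaVec j ᵥ* Mᵀ = alphaVec j ᵥ* (weightMatrix A b j * Mᵀ) ↔ orderDefect A b f Ω j = 0 := by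
  classical
  have hcoord : orderDefect A b f Ω j = ((∑ k, (alphaVec j ᵥ* Mᵀ -
      alphaVec j ᵥ* (weightMatrix A b j * Mᵀ)) k • B k : networkSpan f Ω j) : Ω → E) := by
    have hk : ∀ k, (alphaVec j ᵥ* Mᵀ - alphaVec j ᵥ* (weightMatrix A b j * Mᵀ)) k =
        ∑ T : TreeOfOrder j, T.1.alpha * (1 - T.1.gamma * phi A b T.1) * M k T := by
      intro k
      simp only [Pi.sub_apply, Matrix.vecMul, dotProduct, weightMatrix, Matrix.diagonal_mul,
        Matrix.transpose_apply, alphaVec, ← Finset.sum_sub_distrib]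
      exact Finset.sum_congr rfl fun T _ => by ring
    rw [orderDefect, AddSubmonoidClass.coe_finsetSum]
    simp only [SetLike.val_smul]
    simp only [hk, Finset.sum_smul, hM _, Finset.smul_sum, smul_smul]
    exact Finset.sum_comm
  rw [hcoord, ZeroMemClass.coe_eq_zero, ← sub_eq_zero (a := alphaVec j ᵥ* Mᵀ)]
  constructor
  · intro h
    simp only [h, Pi.zero_apply, zero_smul, Finset.sum_const_zero]
  · intro h
    exact funext (Fintype.linearIndependent_iff.1 B.linearIndependent _ h)

end RungeKutta

theorem mainTheorem2 {d s : ℕ} (A : Matrix (Fin s) (Fin s) ℝ) (b : Fin s → ℝ)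
    (f : EuclideanSpace ℝ (Fin d) → EuclideanSpace ℝ (Fin d))
    (Ω : Set (EuclideanSpace ℝ (Fin d))) (p : ℕ) (hp : 1 ≤ p)
    (hf : ∀ y ∈ Ω, ContDiffAt ℝ (p : WithTop ℕ∞) f y)
    (n : ℕ → ℕ)
    (B : ∀ j, Module.Basis (Fin (n j)) ℝ (RungeKutta.networkSpan f Ω j))
    (M : ∀ j, Matrix (Fin (n j)) (RungeKutta.TreeOfOrder j) ℝ)
    (hM : ∀ j, RungeKutta.Expresses f Ω j (B j) (M j)) :
    (RungeKutta.HasOrder A b f Ω p ↔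
      ∀ j ≤ p, RungeKutta.alphaVec j ᵥ* (M j)ᵀ =
        RungeKutta.alphaVec j ᵥ* (RungeKutta.weightMatrix A b j * (M j)ᵀ)) ∧
    (∀ (j m : ℕ) (B₂ : Module.Basis (Fin m) ℝ (RungeKutta.networkSpan f Ω j))
      (M₂ : Matrix (Fin m) (RungeKutta.TreeOfOrder j) ℝ),
      RungeKutta.Expresses f Ω j B₂ M₂ →
      (RungeKutta.alphaVec j ᵥ* (M₂)ᵀ =
          RungeKutta.alphaVec j ᵥ* (RungeKutta.weightMatrix A b j * (M₂)ᵀ) ↔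
        RungeKutta.alphaVec j ᵥ* (M j)ᵀ =
          RungeKutta.alphaVec j ᵥ* (RungeKutta.weightMatrix A b j * (M j)ᵀ))) := by
  refine ⟨?_, fun j m B₂ M₂ hM₂ => ?_⟩
  · rw [RungeKutta.hasOrder_iff_orderDefect hp hf]
    exact forall₂_congr fun j _ => (RungeKutta.vecMul_eq_iff_orderDefect A b (hM j)).symm
  · exact (RungeKutta.vecMul_eq_iff_orderDefect A b hM₂).trans
      (RungeKutta.vecMul_eq_iff_orderDefect A b (hM j)).symm
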